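/- Let $K$ be a unital commutative $\mathbb Q$-algebra, $t$ a formal central parameter and $z=(z_1,\dots,z_n)$ either commuting or noncommuting variables. Write $K\langle\langle z\rangle\rangle$ and $K[[t]]\langle\langle z\rangle\rangle$ for the algebras of formal power series in $z$ over $K$ and over $K[[t]]$ (in either case), and $o(\cdot)$ for the order in $z$. Let $\alpha\ge 1$ and let $F_t$ be an automorphism of $K[[t]]\langle\langle z\rangle\rangle$ over $K[[t]]$ of the form $F_t(z)=z-H_t(z)$ with $o(H_t(z))\ge\alpha$ and $H_{t=0}(z)=0$. Let $G_t=F_t^{-1}$, $G_t(z)=z+M_t(z)$. For a tuple $c=(c_1,\dots,c_n)$ of power series let $[c\,\frac{\partial}{\partial z}]$ be the derivation which maps $z_i$ to $c_i$ for every $i$. Define sequences $\lambda_m$ ($m\ge 0$) and $\psi_m$ ($m\ge 1$) of $K$-linear operators on $K\langle\langle z\rangle\rangle$ by $$\sum_{m\ge 0}(-t)^m\lambda_m = \big(u_t\mapsto u_t(F_t)\big),\qquad \sum_{m\ge 1}t^{m-1}\psi_m=\Big[\tfrac{\partial M_t}{\partial t}(F_t)\,\tfrac{\partial}{\partial z}\Big].$$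 For a composition $I=(i_1,\dots,i_k)$ (a finite sequence of positive integers) put $\ell(I)=k$, $|I|=i_1+\dots+i_k$, $\bar I=(i_k,\dots,i_1)$, $\pi_u(I)=\prod_{j=1}^k(i_1+\dots+i_j)$ and $w^I=w_{i_1}\cdots w_{i_k}$ for a sequence of operators $w$; let $\mathcal C_m$ be the set of compositions with $|I|=m$. Then for all $m\ge 1$ the operators $\lambda_m$ and $\psi_m$ belong to the unital algebra of differential operators generated by the $K$-derivations of $K\langle\langle z\rangle\rangle$ which increase the degree in $z$ by at least $\alpha-1$, and for every $u(z)\in K\langle\langle z\rangle\rangle$ $$u(F_t(z))=u(z)+\sum_{m\ge1}(-1)^mt^m\,\lambda_m u(z),$$ $$u(F_t(z))=u(z)+\sum_{m\ge1}t^m\sum_{I\in\mathcal C_m}\frac{(-1)^{\ell(I)}}{\pi_u(\bar I)}\,\psi^I u(z),$$ $$u(G_t(z))=u(z)+\sum_{m\ge1}t^m\sum_{I\in\mathcal C_m}(-1)^{\ell(I)-m}\,\lambda^I u(z),$$ $$u(G_t(z))=u(z)+\sum_{m\ge1}t^m\sum_{I\in\mathcal C_m}\frac{1}{\pi_u(I)}\,\psi^I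 u(z).$$ -/

import Mathlib

/-! ### Formal power series in noncommuting variables -/

/-- `R⟨⟨z₁, …, zₙ⟩⟩`: formal power series in `n` noncommuting variables which commute with the
coefficients. A series is the family of its coefficients, indexed by the words in the variables. -/
def NCSeries (n : ℕ) (R : Type*) : Type _ := List (Fin n) → R

namespace NCSeries

variable {n : ℕ} {R : Type*}

@[ext] theorem ext {f g : NCSeries n R} (h : ∀ w, f w = g w) : f = g := funext h

instance [CommRing R] : AddCommGroup (NCSeries n R) :=
  inferInstanceAs (AddCommGroup (List (Fin n) → R))

instance [CommRing R] : Module R (NCSeries n R) :=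
  inferInstanceAs (Module R (List (Fin n) → R))

/-- Cauchy product: the coefficient at `w` is the sum over all factorizations `w = a ++ b`. -/
instance [CommRing R] : Mul (NCSeries n R) :=
  ⟨fun f g w => ∑ p ∈ Finset.range (w.length + 1), f (w.take p) * g (w.drop p)⟩

instance [CommRing R] : One (NCSeries n R) := ⟨fun w => if w = [] then 1 else 0⟩

section lemmas

variable [CommRing R]

@[simp] theorem add_apply (f g : NCSeries n R) (w : List (Fin n)) : (f + g) w = f w + g w := rfl

@[simp] theorem zero_apply (w : List (Fin n)) : (0 : NCSeries n R) w = 0 := rfl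

@[simp] theorem smul_apply (r : R) (f : NCSeries n R) (w : List (Fin n)) :
    (r • f) w = r * f w := rfl

theorem mul_apply (f g : NCSeries n R) (w : List (Fin n)) :
    (f * g) w = ∑ p ∈ Finset.range (w.length + 1), f (w.take p) * g (w.drop p) := rfl

theorem one_apply (w : List (Fin n)) : (1 : NCSeries n R) w = if w = [] then 1 else 0 := rfl

/-- The series whose coefficient at `w` is the coefficient of `f` at `a :: w`. -/
def tail (a : Fin n) (f : NCSeries n R) : NCSeries n R := fun w => f (a :: w)

theorem mul_nil (f g : NCSeries n R) : (f * g) [] = f [] * g [] := by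
  simp [mul_apply]

theorem mul_cons (f g : NCSeries n R) (a : Fin n) (w : List (Fin n)) :
    (f * g) (a :: w) = f [] * g (a :: w) + (tail a f * g) w := by
  simp only [mul_apply, List.length_cons, tail]
  rw [Finset.sum_range_succ']
  simp [add_comm]

theorem tail_mul (f g : NCSeries n R) (a : Fin n) :
    tail a (f * g) = f [] • tail a g + tail a f * g := by
  ext w
  exact mul_cons f g a w

theorem add_mul_aux (f g h : NCSeries n R) : (f + g) * h = f * h + g * h := by
  ext w
  simp [mul_apply, add_mul, Finset.sum_add_distrib]

theorem mul_add_aux (f g h : NCSeries n R) : f * (g + h) = f * g + f * h := by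
  ext w
  simp [mul_apply, mul_add, Finset.sum_add_distrib]

theorem smul_mul_aux (r : R) (f g : NCSeries n R) : (r • f) * g = r • (f * g) := by
  ext w
  simp [mul_apply, Finset.mul_sum, mul_assoc]

theorem mul_smul_aux (r : R) (f g : NCSeries n R) : f * (r • g) = r • (f * g) := by
  ext w
  simp [mul_apply, Finset.mul_sum, mul_left_comm]

theorem mul_assoc_aux (f g h : NCSeries n R) : f * g * h = f * (g * h) := by
  ext w
  induction w generalizing f g with
  | nil => simp [mul_nil, mul_assoc]
  | cons a w ih =>
    rw [mul_cons, mul_cons f, tail_mul, add_mul_aux, add_apply, ih, mul_nil, mul_cons g h,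
      smul_mul_aux, smul_apply]
    ring

theorem zero_mul_aux (f : NCSeries n R) : 0 * f = 0 := by
  ext w
  simp [mul_apply]

theorem one_mul_aux (f : NCSeries n R) : 1 * f = f := by
  ext w
  cases w with
  | nil => simp [mul_nil, one_apply]
  | cons a w =>
    have h : tail a (1 : NCSeries n R) = 0 := by
      ext w
      simp [tail, one_apply]
    simp [mul_cons, h, zero_mul_aux, one_apply]

theorem mul_one_aux (f : NCSeries n R) : f * 1 = f := by
  ext w
  induction w generalizing f with
  | nil => simp [mul_nil, one_apply]
  | cons a w ih =>
    rw [mul_cons, ih]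
    simp [one_apply, tail]

end lemmas

instance [CommRing R] : Ring (NCSeries n R) :=
  { (inferInstance : AddCommGroup (NCSeries n R)) with
    mul := (· * ·)
    one := 1
    mul_assoc := mul_assoc_aux
    one_mul := one_mul_aux
    mul_one := mul_one_aux
    left_distrib := mul_add_aux
    right_distrib := add_mul_aux
    zero_mul := zero_mul_aux
    mul_zero := fun f => by ext w; simp [mul_apply] }

instance [CommRing R] : Algebra R (NCSeries n R) :=
  Algebra.ofModule smul_mul_aux mul_smul_aux

/-- The variable `zᵢ`. -/
def X [CommRing R] (i : Fin n) : NCSeries n R := fun w => if w = [i] then 1 else 0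

/-- `o(f) ≥ d`: every word of length less than `d` has coefficient zero in `f`. -/
def OrderGE [CommRing R] (d : ℕ) (f : NCSeries n R) : Prop := ∀ w, w.length < d → f w = 0

/-- The substitution `u(a₁, …, aₙ)`, for series `aᵢ` without constant term. The product of `l`
such series has order at least `l`, so that only words `v` with `|v| ≤ |w|` contribute to the
coefficient at `w`. -/
def subst [CommRing R] (a : Fin n → NCSeries n R) (u : NCSeries n R) : NCSeries n R := fun w =>
  ∑ l ∈ Finset.range (w.length + 1), ∑ v : Fin l → Fin n,
    u (List.ofFn v) * ((List.ofFn v).map a).prod w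

/-- The underlying map of `NCSeries.bracket`. -/
def bracketFun [CommRing R] (c : Fin n → NCSeries n R) (u : NCSeries n R) : NCSeries n R := fun w =>
  ∑ p ∈ Finset.range (w.length + 1), ∑ q ∈ Finset.range (w.length - p + 1), ∑ i : Fin n,
    u (w.take p ++ [i] ++ (w.drop p).drop q) * c i ((w.drop p).take q)

/-- The derivation `[c ∂/∂z]` of `R⟨⟨z⟩⟩` which maps `zᵢ` to `cᵢ`: it maps a word to the sum of
the products obtained by replacing one of its letters `zᵢ` by `cᵢ`. Hence the coefficient at `w` is
the sum over all factorizations `w = x ++ y ++ x'` and all `i` of the coefficient of `u` at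
`x ++ [i] ++ x'` times the coefficient of `cᵢ` at `y`. -/
def bracket [CommRing R] (c : Fin n → NCSeries n R) : Module.End R (NCSeries n R) where
  toFun := bracketFun c
  map_add' u v := by
    ext w
    simp [bracketFun, add_mul, Finset.sum_add_distrib]
  map_smul' r u := by
    ext w
    simp [bracketFun, Finset.mul_sum, mul_assoc]

section parameter

variable {K : Type*} [CommRing K]

/-- The inclusion of `K⟨⟨z⟩⟩` in `K[[t]]⟨⟨z⟩⟩`. -/
noncomputable def const (u : NCSeries n K) : NCSeries n (PowerSeries K) := fun w => PowerSeries.C (u w)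

/-- The coefficient of `t ^ m` in an element of `K[[t]]⟨⟨z⟩⟩`. -/
noncomputable def tCoeff (m : ℕ) (f : NCSeries n (PowerSeries K)) : NCSeries n K :=
  fun w => PowerSeries.coeff m (f w)

/-- `∂f/∂t`. -/
noncomputable def tDeriv (f : NCSeries n (PowerSeries K)) : NCSeries n (PowerSeries K) :=
  fun w => PowerSeries.derivative K (f w)

/-- The element `∑_{m ≥ 1} t ^ m a_m` of `K[[t]]⟨⟨z⟩⟩`, for `a_m` in `K⟨⟨z⟩⟩`. -/
noncomputable def tSum (a : ℕ → NCSeries n K) : NCSeries n (PowerSeries K) :=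
  fun w => PowerSeries.mk fun m => if 1 ≤ m then a m w else 0

/-- The coefficient `T_m` of `t ^ m` in an operator `T = ∑ t ^ m T_m` on `K[[t]]⟨⟨z⟩⟩`, an operator
on `K⟨⟨z⟩⟩`. -/
noncomputable def opCoeff (m : ℕ) (T : Module.End (PowerSeries K) (NCSeries n (PowerSeries K))) :
    Module.End K (NCSeries n K) where
  toFun u := tCoeff m (T (const u))
  map_add' u v := by
    have h : const (u + v) = const u + const v := by
      ext w : 1
      simp [const]
    ext w
    simp [tCoeff, h]
  map_smul' r u := by
    have h : const (r • u) = (PowerSeries.C r : PowerSeries K) • const u := by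
      ext w : 1
      simp [const]
    ext w
    simp [tCoeff, h]

variable (K n) in
/-- The unital algebra of differential operators generated by the `K`-derivations of `K⟨⟨z⟩⟩` which
increase the degree by at least `α - 1`. -/
def diffOps (α : ℕ) : Subalgebra K (Module.End K (NCSeries n K)) :=
  Algebra.adjoin K {D | (∀ u v, D (u * v) = D u * v + u * D v) ∧
    ∀ d e u, OrderGE d u → e + 1 ≤ d + α → OrderGE e (D u)}

/-- The automorphisms `F_t(z) = z - H_t(z)` of `K[[t]]⟨⟨z⟩⟩` over `K[[t]]` with `o(H_t(z)) ≥ α` and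
`H_{t=0}(z) = 0`. -/
def IsDeformation (α : ℕ)
    (F : NCSeries n (PowerSeries K) ≃ₐ[PowerSeries K] NCSeries n (PowerSeries K)) : Prop :=
  ∀ i, OrderGE α (X i - F (X i)) ∧ tCoeff 0 (X i - F (X i)) = 0

variable (F : NCSeries n (PowerSeries K) ≃ₐ[PowerSeries K] NCSeries n (PowerSeries K))

/-- `F_t(z)`. -/
noncomputable def tuple : Fin n → NCSeries n (PowerSeries K) := fun i => F (X i)

/-- `λ_m`, where `∑ (-t) ^ m λ_m = f(-t)` is the operator `u_t ↦ u_t(F_t)`, i.e. the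
automorphism `F_t` itself. -/
noncomputable def lam (m : ℕ) : Module.End K (NCSeries n K) :=
  (-1 : K) ^ m • opCoeff m F.toLinearMap

/-- `h(t) = [∂M_t/∂t (F_t) ∂/∂z]`, where `G_t = F_t⁻¹` and `M_t(z) = G_t(z) - z`. -/
noncomputable def hOp : Module.End (PowerSeries K) (NCSeries n (PowerSeries K)) :=
  bracket fun i => subst (tuple F) (tDeriv (tuple F.symm i - X i))

/-- `ψ_m` for `m ≥ 1`, where `h(t) = ∑_{m ≥ 1} ψ_m t ^ (m - 1)`. -/
noncomputable def psi (m : ℕ) : Module.End K (NCSeries n K) := opCoeff (m - 1) (hOp F)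

end parameter

end NCSeries

/-! ### The commutative case -/

namespace CommSeries

variable {n : ℕ}

/-- The derivation `[c ∂/∂z] = ∑ cᵢ ∂/∂zᵢ` of `R[[z]]`. -/
noncomputable def bracket {R : Type*} [CommRing R] (c : Fin n → MvPowerSeries (Fin n) R) :
    Module.End R (MvPowerSeries (Fin n) R) :=
  ∑ i, LinearMap.mulLeft R (c i) ∘ₗ (MvPowerSeries.pderiv R i).toLinearMap

variable {K : Type*} [CommRing K]

/-- The inclusion of `K[[z]]` in `K[[t]][[z]]`. -/
noncomputable def const (u : MvPowerSeries (Fin n) K) : MvPowerSeries (Fin n) (PowerSeries K) :=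
  MvPowerSeries.map PowerSeries.C u

/-- The coefficient of `t ^ m` in an element of `K[[t]][[z]]`. -/
noncomputable def tCoeff (m : ℕ) (f : MvPowerSeries (Fin n) (PowerSeries K)) :
    MvPowerSeries (Fin n) K :=
  fun w => PowerSeries.coeff m (MvPowerSeries.coeff w f)

/-- `∂f/∂t`. -/
noncomputable def tDeriv (f : MvPowerSeries (Fin n) (PowerSeries K)) :
    MvPowerSeries (Fin n) (PowerSeries K) :=
  fun w => PowerSeries.derivative K (MvPowerSeries.coeff w f)

/-- The element `∑_{m ≥ 1} t ^ m a_m` of `K[[t]][[z]]`, for `a_m` in `K[[z]]`. -/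
noncomputable def tSum (a : ℕ → MvPowerSeries (Fin n) K) :
    MvPowerSeries (Fin n) (PowerSeries K) :=
  fun w => PowerSeries.mk fun m => if 1 ≤ m then MvPowerSeries.coeff w (a m) else 0

theorem coeff_tCoeff (m : ℕ) (f : MvPowerSeries (Fin n) (PowerSeries K)) (w : Fin n →₀ ℕ) :
    MvPowerSeries.coeff w (tCoeff m f) = PowerSeries.coeff m (MvPowerSeries.coeff w f) := rfl

/-- The coefficient `T_m` of `t ^ m` in an operator `T = ∑ t ^ m T_m` on `K[[t]][[z]]`, an operator
on `K[[z]]`. -/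
noncomputable def opCoeff (m : ℕ)
    (T : Module.End (PowerSeries K) (MvPowerSeries (Fin n) (PowerSeries K))) :
    Module.End K (MvPowerSeries (Fin n) K) where
  toFun u := tCoeff m (T (const u))
  map_add' u v := by
    ext w
    simp [coeff_tCoeff, const]
  map_smul' r u := by
    have h : const (r • u) = (PowerSeries.C r : PowerSeries K) • const u := by
      ext w : 1
      simp [const]
    ext w
    simp [coeff_tCoeff, h]

variable (K n) in
/-- The unital algebra of differential operators generated by the `K`-derivations of `K[[z]]` which
increase the degree by at least `α - 1`. -/
noncomputable def diffOps (α : ℕ) : Subalgebra K (Module.End K (MvPowerSeries (Fin n) K)) :=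
  Algebra.adjoin K {D | (∀ u v, D (u * v) = D u * v + u * D v) ∧
    ∀ u, u.order + α ≤ (D u).order + 1}

/-- The automorphisms `F_t(z) = z - H_t(z)` of `K[[t]][[z]]` over `K[[t]]` with `o(H_t(z)) ≥ α` and
`H_{t=0}(z) = 0`. -/
def IsDeformation (α : ℕ) (F : MvPowerSeries (Fin n) (PowerSeries K) ≃ₐ[PowerSeries K]
    MvPowerSeries (Fin n) (PowerSeries K)) : Prop :=
  ∀ i, (α : ℕ∞) ≤ (MvPowerSeries.X i - F (MvPowerSeries.X i)).order ∧
    tCoeff 0 (MvPowerSeries.X i - F (MvPowerSeries.X i)) = 0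

variable (F : MvPowerSeries (Fin n) (PowerSeries K) ≃ₐ[PowerSeries K]
  MvPowerSeries (Fin n) (PowerSeries K))

/-- `F_t(z)`. -/
noncomputable def tuple : Fin n → MvPowerSeries (Fin n) (PowerSeries K) :=
  fun i => F (MvPowerSeries.X i)

/-- `λ_m`, where `∑ (-t) ^ m λ_m = f(-t)` is the operator `u_t ↦ u_t(F_t)`, i.e. the
automorphism `F_t` itself. -/
noncomputable def lam (m : ℕ) : Module.End K (MvPowerSeries (Fin n) K) :=
  (-1 : K) ^ m • opCoeff m F.toLinearMap

/-- `h(t) = [∂M_t/∂t (F_t) ∂/∂z]`, where `G_t = F_t⁻¹` and `M_t(z) = G_t(z) - z`. -/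
noncomputable def hOp : Module.End (PowerSeries K) (MvPowerSeries (Fin n) (PowerSeries K)) :=
  bracket fun i => MvPowerSeries.subst (tuple F) (tDeriv (tuple F.symm i - MvPowerSeries.X i))

/-- `ψ_m` for `m ≥ 1`, where `h(t) = ∑_{m ≥ 1} ψ_m t ^ (m - 1)`. -/
noncomputable def psi (m : ℕ) : Module.End K (MvPowerSeries (Fin n) K) := opCoeff (m - 1) (hOp F)

end CommSeries

/-! ### Compositions -/

namespace Composition

/-- `π_u(I) = i₁ (i₁ + i₂) ⋯ (i₁ + ⋯ + i_k)` for `I = (i₁, …, i_k)`. -/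
def piU {m : ℕ} (I : Composition m) : ℕ :=
  ∏ j ∈ Finset.range I.length, (I.blocks.take (j + 1)).sum

/-- `w^I = w_{i₁} ⋯ w_{i_k}` for `I = (i₁, …, i_k)`. -/
def monomial {A : Type*} [Monoid A] (w : ℕ → A) {m : ℕ} (I : Composition m) : A :=
  (I.blocks.map w).prod

end Composition

/-! Write `F` and `G` for the automorphism and its inverse, as operators on the series over
`K[[t]]`. The key identity is `h = F ∘ ∂ₜ ∘ G - ∂ₜ` (`IsVelocity.eq`): the right side is a
derivation that kills `K[[t]]` and agrees with `h` on the variables. Evaluated at `F u`, and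
composed with `G` on the left, it gives for `u` constant in `t` the two linear equations `F' = -hF`
and `G' = Gh`.

A `K[[t]]`-linear operator is determined by its values on `t`-constant series, and composition
becomes the Cauchy product of the coefficient operators (`opCoeff_mul`). The equations, together
with `F ∘ G = 1`, thus become recursions on coefficients starting at `1`. Unrolling such a recursion
writes the `m`-th coefficient as a sum over compositions of `m`; dividing by the degree at each
stage produces the partial sums in `piU`. The coefficients of `h` are derivations of the required
order, and the first expansion exhibits every `lam F m` as a polynomial in them.

The argument uses few properties of the series. They are collected in `VariableSystem` and
`DeformationSystem`, so that one proof serves the commuting and the noncommuting case. -/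

/-! ### Recursions solved by sums over compositions. -/

namespace Composition

/-- The composition `(i + 1, J)`. -/
def consSucc (m : ℕ) (p : Σ i : Fin (m + 1), Composition (m - i)) : Composition (m + 1) where
  blocks := ((p.1 : ℕ) + 1) :: p.2.blocks
  blocks_pos := by
    intro i hi
    rcases List.mem_cons.1 hi with rfl | hi
    · exact Nat.succ_pos _
    · exact p.2.blocks_pos hi
  blocks_sum := by
    have := p.1.2
    simp only [List.sum_cons, p.2.blocks_sum]
    omega

theorem consSucc_bijective (m : ℕ) : Function.Bijective (consSucc m) := by
  constructor
  · rintro ⟨i, I⟩ ⟨j, J⟩ h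
    have hb := congrArg Composition.blocks h
    simp only [consSucc, List.cons.injEq, add_left_inj, Fin.val_inj] at hb
    obtain ⟨rfl, hb⟩ := hb
    rw [Composition.ext hb]
  · rintro ⟨blocks, hpos, hsum⟩
    cases blocks with
    | nil => simp at hsum
    | cons b l =>
      have hb : 0 < b := hpos (by simp)
      rw [List.sum_cons] at hsum
      refine ⟨⟨⟨b - 1, by omega⟩, ⟨l, fun h => hpos (by simp [h]), by simp; omega⟩⟩, ?_⟩
      ext1
      simp only [consSucc, List.cons.injEq, and_true]
      omega

/-- Taking `φ` on lists of blocks avoids comparing compositions of different integers. -/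
theorem sum_blocks_succ {M : Type*} [AddCommMonoid M] (φ : List ℕ → M) (m : ℕ) :
    ∑ I : Composition (m + 1), φ I.blocks =
      ∑ i : Fin (m + 1), ∑ J : Composition (m - i), φ (((i : ℕ) + 1) :: J.blocks) := by
  rw [← Fintype.sum_sigma']
  exact (Fintype.sum_bijective _ (consSucc_bijective m) _ _ fun _ => rfl).symm

theorem sum_reverse {M : Type*} [AddCommMonoid M] {m : ℕ} (φ : Composition m → M) :
    ∑ I : Composition m, φ I.reverse = ∑ I : Composition m, φ I :=
  Fintype.sum_bijective _ reverse_bijective _ _ fun _ => rfl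

/-- The product of `c s` over the sums `s` of the nonempty suffixes of a list. -/
def suffixWeight {K : Type*} [CommRing K] (c : ℕ → K) : List ℕ → K
  | [] => 1
  | i :: l => c (i + l.sum) * suffixWeight c l

section recursion

variable {K E : Type*} [CommRing K] [Ring E] [Algebra K E]

/-- Each use of the recursion splits off the first block, and the factor `c` is evaluated at the
degree still to be distributed, which is the sum of the current suffix. Hence the weight is a
product over suffixes. -/
theorem eq_sum_suffixWeight (c : ℕ → K) (w f : ℕ → E) (h0 : f 0 = 1)
    (h : ∀ m, f (m + 1) = c (m + 1) • ∑ i : Fin (m + 1), w (i + 1) * f (m - i)) (m : ℕ) :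
    f m = ∑ I : Composition m, suffixWeight c I.blocks • I.monomial w := by
  induction m using Nat.strong_induction_on with
  | _ m ih =>
    cases m with
    | zero =>
      have : ∀ I : Composition 0, I.blocks = [] := fun I => I.blocks_eq_nil.2 rfl
      simp [h0, monomial, this, suffixWeight, composition_card]
    | succ m =>
      simp only [monomial]
      rw [sum_blocks_succ (fun l => suffixWeight c l • (l.map w).prod), h, Finset.smul_sum]
      refine Finset.sum_congr rfl fun i _ => ?_
      rw [ih (m - i) (by omega), Finset.mul_sum, Finset.smul_sum]
      refine Finset.sum_congr rfl fun J _ => ?_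
      have : (i : ℕ) + 1 + (m - i) = m + 1 := by omega
      simp only [suffixWeight, J.blocks_sum, this, List.map_cons, List.prod_cons, monomial,
        mul_smul, mul_smul_comm]

/-- In the opposite algebra this is the recursion with left multiplication; the reversed order of
the factors is undone by reversing the composition. -/
theorem eq_sum_suffixWeight_reverse (c : ℕ → K) (w f : ℕ → E) (h0 : f 0 = 1)
    (h : ∀ m, f (m + 1) = c (m + 1) • ∑ i : Fin (m + 1), f (m - i) * w (i + 1)) (m : ℕ) :
    f m = ∑ I : Composition m, suffixWeight c I.reverse.blocks • I.monomial w := by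
  have key := eq_sum_suffixWeight c (fun i => MulOpposite.op (w i))
    (fun i => MulOpposite.op (f i)) (by simp [h0]) (fun m => by simp [h]) m
  apply MulOpposite.op_injective
  rw [key, ← sum_reverse, Finset.op_sum]
  refine Finset.sum_congr rfl fun I _ => ?_
  simp only [MulOpposite.op_smul, monomial, MulOpposite.op_list_prod, reverse, List.map_map,
    List.map_reverse]
  rfl

end recursion

theorem suffixWeight_const {K : Type*} [CommRing K] (a : K) (l : List ℕ) :
    suffixWeight (fun _ => a) l = a ^ l.length := by
  induction l with
  | nil => simp [suffixWeight]
  | cons i l ih => rw [suffixWeight, ih, List.length_cons, pow_succ']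

/-- Prefixes of the reversed list are reversed suffixes of `l`. The head of `l` enters only the
longest prefix, which is the last factor of the product. -/
theorem prod_sum_take_reverse (l : List ℕ) :
    ((∏ j ∈ Finset.range l.reverse.length, (l.reverse.take (j + 1)).sum : ℕ) : ℚ) =
      suffixWeight (fun i => (i : ℚ)) l := by
  induction l with
  | nil => simp [suffixWeight]
  | cons i l ih =>
    rw [suffixWeight, ← ih, List.reverse_cons, List.length_append, List.length_singleton,
      Finset.prod_range_succ, Nat.cast_mul, mul_comm]
    congr 1
    · rw [List.take_of_length_le (by simp)]
      simp [add_comm]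
    · congr 1
      refine Finset.prod_congr rfl fun j hj => ?_
      rw [List.take_append_of_le_length (by simpa using hj)]

theorem piU_reverse {m : ℕ} (I : Composition m) :
    (I.reverse.piU : ℚ) = suffixWeight (fun i => (i : ℚ)) I.blocks := by
  rw [← prod_sum_take_reverse, piU, ← blocks_length]
  rfl

theorem suffixWeight_algebraMap_div {K : Type*} [CommRing K] [Algebra ℚ K] (a : ℚ) (l : List ℕ) :
    suffixWeight (fun i => algebraMap ℚ K (a / i)) l =
      algebraMap ℚ K (a ^ l.length / suffixWeight (fun i => (i : ℚ)) l) := by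
  induction l with
  | nil => simp [suffixWeight]
  | cons i l ih =>
    rw [suffixWeight, suffixWeight, ih, ← map_mul, List.length_cons, pow_succ', mul_div_mul_comm]

section rational

variable {K E : Type*} [CommRing K] [Algebra ℚ K] [Ring E] [Algebra K E]

/-- Characteristic zero enters here: `m + 1` is invertible in `K`, so a derivative determines the
next coefficient. -/
theorem eq_algebraMap_div_smul {a : ℚ} {m : ℕ} {x y : E}
    (h : (m + 1) • x = algebraMap ℚ K a • y) :
    x = algebraMap ℚ K (a / (m + 1 : ℕ)) • y := by
  rw [div_eq_inv_mul, map_mul, mul_smul, ← h, ← Nat.cast_smul_eq_nsmul K, smul_smul,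
    ← map_natCast (algebraMap ℚ K), ← map_mul, inv_mul_cancel₀ (by positivity), map_one, one_smul]

/-- The solution of `f' = -w f`, `f 0 = 1`. -/
theorem eq_sum_of_derivative_eq_neg_mul (w f : ℕ → E) (h0 : f 0 = 1)
    (h : ∀ m, (m + 1) • f (m + 1) = -∑ i : Fin (m + 1), w (i + 1) * f (m - i)) (m : ℕ) :
    f m = ∑ I : Composition m,
      algebraMap ℚ K ((-1) ^ I.length / (I.reverse.piU : ℚ)) • I.monomial w := by
  rw [eq_sum_suffixWeight (fun i => algebraMap ℚ K (-1 / i)) w f h0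
    (fun m => eq_algebraMap_div_smul (by rw [h]; simp))]
  simp [suffixWeight_algebraMap_div, piU_reverse]

/-- The solution of `f' = f w`, `f 0 = 1`. -/
theorem eq_sum_of_derivative_eq_mul (w f : ℕ → E) (h0 : f 0 = 1)
    (h : ∀ m, (m + 1) • f (m + 1) = ∑ i : Fin (m + 1), f (m - i) * w (i + 1)) (m : ℕ) :
    f m = ∑ I : Composition m, algebraMap ℚ K (1 / (I.piU : ℚ)) • I.monomial w := by
  rw [eq_sum_suffixWeight_reverse (fun i => algebraMap ℚ K (1 / i)) w f h0
    (fun m => eq_algebraMap_div_smul (by rw [h]; simp))]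
  refine Finset.sum_congr rfl fun I _ => ?_
  rw [suffixWeight_algebraMap_div, ← piU_reverse, reverse_reverse, one_pow]

end rational

/-- The inverse of a series with constant coefficient one whose coefficients are `(-1) ^ m w_m`. -/
theorem eq_sum_of_inverse {K E : Type*} [CommRing K] [Ring E] [Algebra K E] (w g : ℕ → E)
    (h0 : g 0 = 1)
    (h : ∀ m, g (m + 1) = -∑ i : Fin (m + 1), ((-1 : K) ^ ((i : ℕ) + 1) • w (i + 1)) * g (m - i))
    (m : ℕ) :
    g m = ∑ I : Composition m, (-1 : K) ^ (m - I.length) • I.monomial w := by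
  -- The minus sign of the recursion is the constant weight and yields `(-1) ^ ℓ(I)`; the signs on
  -- the letters multiply to `(-1) ^ |I|`.
  rw [eq_sum_suffixWeight (fun _ => (-1 : K)) (fun i => (-1 : K) ^ i • w i) g h0
    (fun m => by rw [h]; simp)]
  refine Finset.sum_congr rfl fun I _ => ?_
  have hl : ∀ l : List ℕ, (l.map fun i => (-1 : K) ^ i • w i).prod =
      (-1 : K) ^ l.sum • (l.map w).prod := by
    intro l
    induction l with
    | nil => simp
    | cons i l ih => simp [ih, pow_add, smul_smul, mul_comm]
  rw [suffixWeight_const, monomial, hl, I.blocks_sum, smul_smul, ← pow_add, monomial,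
    I.blocks_length]
  congr 1
  -- Since `ℓ(I) ≤ m`, the subtraction in the exponent is exact, and `ℓ(I) + m` has the same parity
  -- as `m - ℓ(I)`.
  obtain ⟨k, hk⟩ := Nat.exists_eq_add_of_le I.length_le
  rw [show I.length + m = 2 * I.length + k by omega, show m - I.length = k by omega, pow_add,
    pow_mul, neg_one_sq, one_pow, one_mul]

end Composition

/-! ### Series algebras with variables and order, axiomatically. -/

/-- The structure of an algebra of formal power series in variables `X i`: the constant coefficient
`ε`, the decreasing filtration `fil` by the order, and for every series `u` a decomposition
`u = ε u + ∑ X i * tail i u`. -/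
structure VariableSystem (R A ι : Type*) [CommRing R] [Ring A] [Algebra R A] [Fintype ι] where
  X : ι → A
  ε : A → R
  tail : ι → A → A
  fil : ℕ → Submodule R A
  decomp : ∀ u, u = algebraMap R A (ε u) + ∑ i, X i * tail i u
  mem_fil_zero : ∀ u, u ∈ fil 0
  fil_anti : Antitone fil
  mul_mem : ∀ {p q f g}, f ∈ fil p → g ∈ fil q → f * g ∈ fil (p + q)
  X_mem : ∀ i, X i ∈ fil 1
  tail_mem : ∀ {d u} i, u ∈ fil d → tail i u ∈ fil (d - 1)
  ε_eq_zero : ∀ {u}, u ∈ fil 1 → ε u = 0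
  ε_algebraMap : ∀ r, ε (algebraMap R A r) = r
  eq_zero : ∀ {u}, (∀ d, u ∈ fil d) → u = 0

namespace VariableSystem

variable {R A ι : Type*} [CommRing R] [Ring A] [Algebra R A] [Fintype ι]
  (V : VariableSystem R A ι)

theorem mul_mem' {p q d : ℕ} {f g : A} (hf : f ∈ V.fil p) (hg : g ∈ V.fil q) (h : d ≤ p + q) :
    f * g ∈ V.fil d :=
  V.fil_anti h (V.mul_mem hf hg)

/-- A map which satisfies `δ u = ∑ a i * δ (τ i u)` with `a i` of positive order vanishes. -/
theorem eq_zero_of_forall_eq_sum {δ : A → A} {a : ι → A} (ha : ∀ i, a i ∈ V.fil 1)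
    (h : ∀ u, δ u = ∑ i, a i * δ (V.tail i u)) (u : A) : δ u = 0 := by
  refine V.eq_zero fun d => ?_
  -- Each application of the identity gains one order from `a i`, so the value lies in every step of
  -- the filtration.
  induction d generalizing u with
  | zero => exact V.mem_fil_zero _
  | succ d ih =>
    rw [h]
    exact sum_mem fun i _ => V.mul_mem' (ha i) (ih _) (by omega)

section AlgHom

theorem map_decomp {F B : Type*} [Ring B] [Algebra R B] [FunLike F A B] [AlgHomClass F R A B]
    (f : F) (u : A) :
    f u = algebraMap R B (V.ε u) + ∑ i, f (V.X i) * f (V.tail i u) := by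
  conv_lhs => rw [V.decomp u]
  simp [AlgHomClass.commutes]

variable {F F' : Type*} [FunLike F A A] [AlgHomClass F R A A]

/-- The difference of the two maps satisfies the homogeneous recursion. As `s` need not be additive,
this applies directly to a substitution formula. -/
theorem map_eq_of_recursion (f : F) {s : A → A} (hf : ∀ i, f (V.X i) ∈ V.fil 1)
    (hs : ∀ u, s u = algebraMap R A (V.ε u) + ∑ i, f (V.X i) * s (V.tail i u)) (u : A) :
    f u = s u := by
  refine sub_eq_zero.1 (V.eq_zero_of_forall_eq_sum (δ := fun u => f u - s u) hf ?_ u)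
  intro u
  simp only [V.map_decomp f u, hs u, mul_sub, Finset.sum_sub_distrib]
  abel

theorem map_mem (f : F) (hf : ∀ i, f (V.X i) ∈ V.fil 1) {d : ℕ} {u : A} (hu : u ∈ V.fil d) :
    f u ∈ V.fil d := by
  induction d generalizing u with
  | zero => exact V.mem_fil_zero _
  | succ d ih =>
    rw [V.map_decomp f u, V.ε_eq_zero (V.fil_anti (by omega) hu), map_zero, zero_add]
    exact sum_mem fun i _ => V.mul_mem' (hf i) (ih (V.tail_mem i hu)) (by omega)

/-- The defect on a product `X i * v` is `X i` times the defect on `v`, minus `X i - f (X i)` times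
`f v`. The first term gains one order, the second already has order `α`. -/
theorem map_sub_self_mem (f : F) {α : ℕ} (hf : ∀ i, V.X i - f (V.X i) ∈ V.fil α)
    (u : A) : f u - u ∈ V.fil α := by
  suffices h : ∀ d ≤ α, ∀ u, f u - u ∈ V.fil d from h α le_rfl u
  intro d
  induction d with
  | zero => exact fun _ _ => V.mem_fil_zero _
  | succ d ih =>
    intro hd u
    have : f u - u = ∑ i, (V.X i * (f (V.tail i u) - V.tail i u) -
        (V.X i - f (V.X i)) * f (V.tail i u)) := by
      conv_lhs => rw [V.map_decomp f u]; enter [2]; rw [V.decomp u]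
      rw [add_sub_add_left_eq_sub, ← Finset.sum_sub_distrib]
      exact Finset.sum_congr rfl fun i _ => by noncomm_ring
    rw [this]
    exact sum_mem fun i _ => sub_mem (V.mul_mem' (V.X_mem i) (ih (by omega) _) (by omega))
      (V.mul_mem' (hf i) (V.mem_fil_zero _) hd)

end AlgHom

theorem map_X_mem (f : A → A) {α : ℕ} (hα : 1 ≤ α) (hf : ∀ i, V.X i - f (V.X i) ∈ V.fil α) (i : ι) :
    f (V.X i) ∈ V.fil 1 := by
  simpa using sub_mem (V.X_mem i) (V.fil_anti hα (hf i))

theorem mem_fil_one {u : A} (h : V.ε u = 0) : u ∈ V.fil 1 := by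
  rw [V.decomp u, h, map_zero, zero_add]
  exact sum_mem fun i _ => V.mul_mem' (V.X_mem i) (V.mem_fil_zero _) le_rfl

/-- Applying `f` to the decomposition of `f.symm (X i)` writes its constant coefficient as `X i`
minus terms of positive order; a constant of positive order is zero. -/
theorem symm_X_mem (f : A ≃ₐ[R] A) (hf : ∀ i, f (V.X i) ∈ V.fil 1) (i : ι) :
    f.symm (V.X i) ∈ V.fil 1 := by
  refine V.mem_fil_one ?_
  have h : algebraMap R A (V.ε (f.symm (V.X i))) ∈ V.fil 1 := by
    have h := V.map_decomp f (f.symm (V.X i))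
    rw [AlgEquiv.apply_symm_apply] at h
    rw [← sub_eq_iff_eq_add.2 h]
    exact sub_mem (V.X_mem i) (sum_mem fun j _ =>
      V.mul_mem' (hf j) (V.mem_fil_zero _) le_rfl)
  simpa [V.ε_algebraMap] using V.ε_eq_zero h

/-- This is the bound for `f v - v` at `v = f.symm (X i)`, up to sign. -/
theorem symm_sub_mem (f : A ≃ₐ[R] A) {α : ℕ}
    (hf : ∀ i, V.X i - f (V.X i) ∈ V.fil α) (i : ι) : f.symm (V.X i) - V.X i ∈ V.fil α := by
  simpa using neg_mem (V.map_sub_self_mem f hf (f.symm (V.X i)))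

/-- A derivation with `D (X i)` of order at least `α` increases the order by at least `α - 1`. -/
theorem derivation_mem {D : A → A} {α : ℕ} (hD : ∀ i, D (V.X i) ∈ V.fil α)
    (h : ∀ u, D u = ∑ i, (D (V.X i) * V.tail i u + V.X i * D (V.tail i u))) {d e : ℕ} {u : A}
    (hu : u ∈ V.fil d) (he : e + 1 ≤ d + α) : D u ∈ V.fil e := by
  induction e generalizing d u with
  | zero => exact V.mem_fil_zero _
  | succ e ih =>
    rw [h]
    exact sum_mem fun i _ => add_mem (V.mul_mem' (hD i) (V.tail_mem i hu) (by omega))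
      (V.mul_mem' (V.X_mem i) (ih (V.tail_mem i hu) (by omega)) (by omega))

end VariableSystem

/-! ### Expansion in the parameter `t` of series and operators. -/

/-- The structure of `A = A₀[[t]]`: the inclusion of the constant series, the coefficients of the
powers of `t`, the division of the nonconstant part by `t`, and the derivative. -/
structure ParameterSystem (K A₀ A : Type*) [CommRing K] [Ring A₀] [Algebra K A₀] [Ring A]
    [Algebra (PowerSeries K) A] where
  const : A₀ → A
  coeff : ℕ → A →+ A₀
  shift : A → A
  deriv : A →+ A
  ext : ∀ {f g}, (∀ m, coeff m f = coeff m g) → f = g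
  coeff_const : ∀ m u, coeff m (const u) = if m = 0 then u else 0
  coeff_smul : ∀ m (r : PowerSeries K) f, coeff m (r • f) =
    ∑ p ∈ Finset.HasAntidiagonal.antidiagonal m, PowerSeries.coeff p.1 r • coeff p.2 f
  coeff_mul_const : ∀ m f u, coeff m (f * const u) = coeff m f * u
  coeff_const_mul : ∀ m f u, coeff m (const u * f) = u * coeff m f
  shift_spec : ∀ f, f = const (coeff 0 f) + (PowerSeries.X : PowerSeries K) • shift f
  coeff_deriv : ∀ m f, coeff m (deriv f) = (m + 1) • coeff (m + 1) f
  deriv_mul : ∀ f g, deriv (f * g) = deriv f * g + f * deriv g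
  deriv_smul : ∀ (r : PowerSeries K) f, deriv (r • f) =
    PowerSeries.derivative K r • f + r • deriv f

namespace ParameterSystem

variable {K A₀ A : Type*} [CommRing K] [Ring A₀] [Algebra K A₀] [Ring A]
  [Algebra (PowerSeries K) A] (T : ParameterSystem K A₀ A)

theorem const_add (u v : A₀) : T.const (u + v) = T.const u + T.const v :=
  T.ext fun m => by simp only [map_add, T.coeff_const]; split_ifs <;> simp

theorem coeff_C_smul (m : ℕ) (r : K) (f : A) :
    T.coeff m ((PowerSeries.C r : PowerSeries K) • f) = r • T.coeff m f := by
  rw [T.coeff_smul, Finset.sum_eq_single (0, m)]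
  · simp
  · rintro ⟨i, j⟩ h h'
    have hi : i ≠ 0 := by
      rintro rfl
      simp_all
    simp [PowerSeries.coeff_C, hi]
  · simp

theorem const_smul (r : K) (u : A₀) :
    T.const (r • u) = (PowerSeries.C r : PowerSeries K) • T.const u :=
  T.ext fun m => by rw [T.coeff_C_smul]; simp only [T.coeff_const]; split_ifs <;> simp

theorem const_mul (u v : A₀) : T.const (u * v) = T.const u * T.const v :=
  T.ext fun m => by rw [T.coeff_mul_const]; simp only [T.coeff_const]; split_ifs <;> simp

theorem coeff_zero_X_smul (f : A) : T.coeff 0 ((PowerSeries.X : PowerSeries K) • f) = 0 := by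
  simp [T.coeff_smul]

theorem coeff_succ_X_smul (m : ℕ) (f : A) :
    T.coeff (m + 1) ((PowerSeries.X : PowerSeries K) • f) = T.coeff m f := by
  rw [T.coeff_smul, Finset.sum_eq_single (1, m)]
  · simp
  · rintro ⟨i, j⟩ h h'
    have hi : i ≠ 1 := by
      rintro rfl
      simp only [Finset.HasAntidiagonal.mem_antidiagonal] at h
      exact h' (by simp; omega)
    simp [PowerSeries.coeff_X, hi]
  · intro h
    exact absurd (by simp [add_comm]) h

theorem coeff_shift (m : ℕ) (f : A) : T.coeff m (T.shift f) = T.coeff (m + 1) f := by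
  conv_rhs => rw [T.shift_spec f, map_add, T.coeff_succ_X_smul, T.coeff_const]
  simp

theorem deriv_const (u : A₀) : T.deriv (T.const u) = 0 :=
  T.ext fun m => by simp [T.coeff_deriv, T.coeff_const]

theorem deriv_one : T.deriv 1 = 0 := by
  simpa using T.deriv_mul 1 1

theorem deriv_algebraMap (r : PowerSeries K) :
    T.deriv (algebraMap _ A r) = algebraMap _ A (PowerSeries.derivative K r) := by
  rw [Algebra.algebraMap_eq_smul_one, T.deriv_smul, T.deriv_one, smul_zero, add_zero,
    Algebra.algebraMap_eq_smul_one]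

theorem const_one : T.const 1 = 1 := by
  rw [← mul_one (T.const 1)]
  exact T.ext fun m => by rw [T.coeff_const_mul, one_mul]

theorem const_algebraMap (r : K) :
    T.const (algebraMap K A₀ r) = algebraMap (PowerSeries K) A (PowerSeries.C r) := by
  rw [Algebra.algebraMap_eq_smul_one, T.const_smul, T.const_one, Algebra.algebraMap_eq_smul_one]

theorem coeff_zero_mul (f g : A) : T.coeff 0 (f * g) = T.coeff 0 f * T.coeff 0 g := by
  conv_lhs => rw [T.shift_spec f, add_mul, smul_mul_assoc, map_add, T.coeff_zero_X_smul,
    T.coeff_const_mul, add_zero]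

theorem coeff_zero_algebraMap (r : K) :
    T.coeff 0 (algebraMap (PowerSeries K) A (PowerSeries.C r)) = algebraMap K A₀ r := by
  rw [← T.const_algebraMap, T.coeff_const, if_pos rfl]

/-- The coefficient of `t ^ m` in an operator on `A`. -/
noncomputable def opCoeff (m : ℕ) (S : Module.End (PowerSeries K) A) : Module.End K A₀ where
  toFun u := T.coeff m (S (T.const u))
  map_add' u v := by simp [T.const_add]
  map_smul' r u := by simp [T.const_smul, T.coeff_C_smul]

theorem opCoeff_apply (m : ℕ) (S : Module.End (PowerSeries K) A) (u : A₀) :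
    T.opCoeff m S u = T.coeff m (S (T.const u)) := rfl

/-- Write `f = f₀ + t f₁`; linearity over `K[[t]]` moves `t` outside and lowers `m`. Only finitely
many steps occur, so no continuity of `S` in `t` is needed. -/
theorem coeff_map (S : Module.End (PowerSeries K) A) (m : ℕ) (f : A) :
    T.coeff m (S f) = ∑ i : Fin (m + 1), T.opCoeff i S (T.coeff (m - i) f) := by
  induction m generalizing f with
  | zero =>
    conv_lhs => rw [T.shift_spec f, map_add, map_smul, map_add, T.coeff_zero_X_smul]
    simp [opCoeff_apply]
  | succ m ih =>
    conv_lhs => rw [T.shift_spec f, map_add, map_smul, map_add, T.coeff_succ_X_smul, ih]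
    conv_rhs => rw [Fin.sum_univ_castSucc]
    rw [add_comm]
    refine congrArg₂ _ ?_ ?_
    · refine Finset.sum_congr rfl fun i _ => ?_
      have := i.2
      rw [T.coeff_shift, Fin.val_castSucc, show m - i + 1 = m + 1 - i by omega]
    · simp [opCoeff_apply]

theorem opCoeff_mul (S S' : Module.End (PowerSeries K) A) (m : ℕ) :
    T.opCoeff m (S * S') = ∑ i : Fin (m + 1), T.opCoeff i S * T.opCoeff (m - i) S' := by
  ext u
  simp [opCoeff_apply, T.coeff_map S m]

theorem opCoeff_one (m : ℕ) :
    T.opCoeff m (1 : Module.End (PowerSeries K) A) = if m = 0 then 1 else 0 := by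
  ext u
  simp only [opCoeff_apply, Module.End.one_apply, T.coeff_const]
  split_ifs <;> simp

theorem opCoeff_derivation {D : Module.End (PowerSeries K) A}
    (hD : ∀ u v, D (u * v) = D u * v + u * D v) (m : ℕ) (u v : A₀) :
    T.opCoeff m D (u * v) = T.opCoeff m D u * v + u * T.opCoeff m D v := by
  simp [opCoeff_apply, T.const_mul, hD, T.coeff_mul_const, T.coeff_const_mul]

end ParameterSystem

/-! ### The differential equations of the deformation. -/

/-- The data of a `K`-algebra `A₀` of formal power series and of the algebra `A = A₀[[t]]`. -/
structure DeformationSystem (K A₀ A ι : Type*) [CommRing K] [Ring A₀] [Algebra K A₀] [Ring A]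
    [Algebra (PowerSeries K) A] [Fintype ι] extends ParameterSystem K A₀ A where
  V₀ : VariableSystem K A₀ ι
  V : VariableSystem (PowerSeries K) A ι
  const_X : ∀ i, const (V₀.X i) = V.X i
  const_mem : ∀ {d u}, u ∈ V₀.fil d → const u ∈ V.fil d
  coeff_mem : ∀ {d f} m, f ∈ V.fil d → coeff m f ∈ V₀.fil d
  deriv_mem : ∀ {d f}, f ∈ V.fil d → deriv f ∈ V.fil d

namespace DeformationSystem

variable {K A₀ A ι : Type*} [CommRing K] [Ring A₀] [Algebra K A₀] [Ring A]
  [Algebra (PowerSeries K) A] [Fintype ι] (S : DeformationSystem K A₀ A ι)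

/-- The automorphisms `F` with `F(z) = z - H`, `o(H) ≥ α`, `H_{t = 0} = 0`. -/
def IsDeformation (α : ℕ) (F : A ≃ₐ[PowerSeries K] A) : Prop :=
  ∀ i, S.V.X i - F (S.V.X i) ∈ S.V.fil α ∧ S.coeff 0 (S.V.X i - F (S.V.X i)) = 0

variable {α : ℕ} {F : A ≃ₐ[PowerSeries K] A} {h : Module.End (PowerSeries K) A}

/-- Setting `t = 0` in `F` gives a multiplicative map on `A₀` that fixes scalars and variables,
hence the identity by the vanishing principle for the recursion on tails. -/
theorem opCoeff_zero_eq_one (hF : S.IsDeformation α F) :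
    S.opCoeff 0 F.toLinearMap = 1 := by
  have hX : ∀ i, S.coeff 0 (F (S.V.X i)) = S.V₀.X i := by
    intro i
    have := (hF i).2
    rw [map_sub, sub_eq_zero, ← S.const_X, S.coeff_const, if_pos rfl, S.const_X] at this
    exact this.symm
  ext u
  refine sub_eq_zero.1 (S.V₀.eq_zero_of_forall_eq_sum
    (δ := fun u => S.opCoeff 0 F.toLinearMap u - u) S.V₀.X_mem ?_ u)
  intro u
  have h : S.opCoeff 0 F.toLinearMap u = algebraMap K A₀ (S.V₀.ε u) +
      ∑ i, S.V₀.X i * S.opCoeff 0 F.toLinearMap (S.V₀.tail i u) := by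
    conv_lhs => rw [S.V₀.decomp u]
    rw [map_add, map_sum]
    congr 1
    · simp [ParameterSystem.opCoeff_apply, S.const_algebraMap, S.coeff_zero_algebraMap]
    · simp [ParameterSystem.opCoeff_apply, S.const_mul, S.coeff_zero_mul, S.const_X, hX]
  conv_lhs => enter [2]; rw [S.V₀.decomp u]
  simp only [h, mul_sub, Finset.sum_sub_distrib]
  abel

theorem toLinearMap_mul_symm (F : A ≃ₐ[PowerSeries K] A) :
    (F.toLinearMap * F.symm.toLinearMap : Module.End (PowerSeries K) A) = 1 := by
  ext u
  simp

theorem opCoeff_symm_zero_eq_one (hF : S.IsDeformation α F) :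
    S.opCoeff 0 F.symm.toLinearMap = 1 := by
  have := S.opCoeff_mul F.toLinearMap F.symm.toLinearMap 0
  rw [toLinearMap_mul_symm, S.opCoeff_one] at this
  simpa [S.opCoeff_zero_eq_one hF] using this.symm

theorem opCoeff_symm_succ (hF : S.IsDeformation α F) (m : ℕ) :
    S.opCoeff (m + 1) F.symm.toLinearMap =
      -∑ i : Fin (m + 1), S.opCoeff (i + 1) F.toLinearMap *
        S.opCoeff (m - i) F.symm.toLinearMap := by
  have := S.opCoeff_mul F.toLinearMap F.symm.toLinearMap (m + 1)
  rw [toLinearMap_mul_symm, S.opCoeff_one, if_neg (by omega), Fin.sum_univ_succ] at this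
  simp only [Fin.val_zero, S.opCoeff_zero_eq_one hF, one_mul, Fin.val_succ, Nat.sub_zero,
    Nat.reduceSubDiff] at this
  exact eq_neg_of_add_eq_zero_left this.symm

/-- The operator `h` is the derivation of `A` which maps `X i` to `∂M_i/∂t (F)`. -/
def IsVelocity (F : A ≃ₐ[PowerSeries K] A) (h : Module.End (PowerSeries K) A) : Prop :=
  ∀ u, h u = ∑ i, (F (S.deriv (F.symm (S.V.X i) - S.V.X i)) * S.V.tail i u +
    S.V.X i * h (S.V.tail i u))

theorem deriv_X (i : ι) : S.deriv (S.V.X i) = 0 := by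
  rw [← S.const_X, S.deriv_const]

/-- A conjugate of a derivation by an automorphism is a derivation, and so is its difference with
`∂ₜ`. -/
theorem conj_deriv_mul (F : A ≃ₐ[PowerSeries K] A) (u v : A) :
    F (S.deriv (F.symm (u * v))) - S.deriv (u * v) =
      (F (S.deriv (F.symm u)) - S.deriv u) * v + u * (F (S.deriv (F.symm v)) - S.deriv v) := by
  simp only [map_mul, S.deriv_mul, map_add, AlgEquiv.apply_symm_apply]
  noncomm_ring

/-- Both sides obey the same recursion on tails: the right side by the Leibniz rule, with `∂ₜ (X i)
= 0` giving its value on the variables. -/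
theorem IsVelocity.eq (hh : S.IsVelocity F h) (u : A) :
    h u = F (S.deriv (F.symm u)) - S.deriv u := by
  refine sub_eq_zero.1 (S.V.eq_zero_of_forall_eq_sum
    (δ := fun u => h u - (F (S.deriv (F.symm u)) - S.deriv u)) S.V.X_mem ?_ u)
  intro u
  have hD : F (S.deriv (F.symm u)) - S.deriv u =
      ∑ i, (F (S.deriv (F.symm (S.V.X i) - S.V.X i)) * S.V.tail i u +
        S.V.X i * (F (S.deriv (F.symm (S.V.tail i u))) - S.deriv (S.V.tail i u))) := by
    conv_lhs => rw [S.V.decomp u]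
    -- On a scalar `r` in `K[[t]]`, which `F` fixes, both terms equal `∂r/∂t`: neither derivation is
    -- linear over `K[[t]]`, but their difference is.
    have : ∀ r, F (S.deriv (F.symm (algebraMap (PowerSeries K) A r))) -
        S.deriv (algebraMap (PowerSeries K) A r) = 0 := fun r => by
      simp [S.deriv_algebraMap]
    rw [map_add, map_add, map_add, map_add, add_sub_add_comm, this, zero_add, map_sum, map_sum,
      map_sum, map_sum, ← Finset.sum_sub_distrib]
    refine Finset.sum_congr rfl fun i _ => ?_
    rw [S.conj_deriv_mul, map_sub, S.deriv_X, sub_zero, sub_zero]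
  simp only [hD, hh u, Finset.sum_add_distrib, mul_sub, Finset.sum_sub_distrib]
  abel

theorem IsVelocity.map_mul (hh : S.IsVelocity F h) (u v : A) :
    h (u * v) = h u * v + u * h v := by
  simp only [hh.eq, S.conj_deriv_mul]

theorem IsVelocity.apply_X (hh : S.IsVelocity F h) (i : ι) :
    h (S.V.X i) = F (S.deriv (F.symm (S.V.X i) - S.V.X i)) := by
  rw [hh.eq, map_sub, S.deriv_X, sub_zero, sub_zero]

theorem IsVelocity.apply_mem (hα : 1 ≤ α) (hF : S.IsDeformation α F) (hh : S.IsVelocity F h)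
    {d e : ℕ} {u : A} (hu : u ∈ S.V.fil d) (he : e + 1 ≤ d + α) : h u ∈ S.V.fil e := by
  have hX := S.V.map_X_mem F hα fun i => (hF i).1
  refine S.V.derivation_mem (fun i => ?_) (fun u => ?_) hu he
  · rw [hh.apply_X]
    exact S.V.map_mem F hX (S.deriv_mem (S.V.symm_sub_mem F (fun i => (hF i).1) i))
  · simp only [hh.apply_X]
    exact hh u

theorem IsVelocity.opCoeff_mem (hα : 1 ≤ α) (hF : S.IsDeformation α F) (hh : S.IsVelocity F h)
    (m : ℕ) {d e : ℕ} {u : A₀} (hu : u ∈ S.V₀.fil d) (he : e + 1 ≤ d + α) :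
    S.opCoeff m h u ∈ S.V₀.fil e :=
  S.coeff_mem m (hh.apply_mem S hα hF (S.const_mem hu) he)

theorem IsVelocity.opCoeff_mul (hh : S.IsVelocity F h) (m : ℕ) (u v : A₀) :
    S.opCoeff m h (u * v) = S.opCoeff m h u * v + u * S.opCoeff m h v :=
  S.opCoeff_derivation (hh.map_mul S) m u v

/-- Evaluate `h = F ∘ ∂ₜ ∘ F⁻¹ - ∂ₜ` at `F u` with `u` constant in `t`: the first term vanishes,
leaving `h F u = -∂ₜ (F u)`. -/
theorem IsVelocity.smul_opCoeff (hh : S.IsVelocity F h) (m : ℕ) :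
    (m + 1) • S.opCoeff (m + 1) F.toLinearMap =
      -∑ i : Fin (m + 1), S.opCoeff i h * S.opCoeff (m - i) F.toLinearMap := by
  rw [← S.toParameterSystem.opCoeff_mul]
  ext u
  simp [ParameterSystem.opCoeff_apply, hh.eq, S.deriv_const, S.coeff_deriv, add_mul]

/-- Compose with `F⁻¹` on the left: `F⁻¹ h = ∂ₜ F⁻¹ - F⁻¹ ∂ₜ`, whose last term vanishes on series
constant in `t`. -/
theorem IsVelocity.smul_opCoeff_symm (hh : S.IsVelocity F h) (m : ℕ) :
    (m + 1) • S.opCoeff (m + 1) F.symm.toLinearMap =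
      ∑ i : Fin (m + 1), S.opCoeff (m - i) F.symm.toLinearMap * S.opCoeff i h := by
  have : ∑ i : Fin (m + 1), S.opCoeff (m - i) F.symm.toLinearMap * S.opCoeff i h =
      ∑ i : Fin (m + 1), S.opCoeff i F.symm.toLinearMap * S.opCoeff (m - i) h := by
    rw [← Equiv.sum_comp Fin.revPerm]
    refine Finset.sum_congr rfl fun i _ => ?_
    have := i.2
    simp only [Fin.revPerm_apply, Fin.val_rev]
    rw [show m - (m + 1 - ((i : ℕ) + 1)) = i by omega, show m + 1 - ((i : ℕ) + 1) = m - i by omega]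
  rw [this, ← S.toParameterSystem.opCoeff_mul]
  ext u
  simp [ParameterSystem.opCoeff_apply, hh.eq, S.deriv_const, S.coeff_deriv, add_mul]

theorem opCoeff_symm_eq_sum_lam (hF : S.IsDeformation α F) (m : ℕ) :
    S.opCoeff m F.symm.toLinearMap = ∑ I : Composition m,
      (-1 : K) ^ (m - I.length) • I.monomial fun i => (-1 : K) ^ i • S.opCoeff i F.toLinearMap :=
  Composition.eq_sum_of_inverse _ (fun m => S.opCoeff m F.symm.toLinearMap)
    (S.opCoeff_symm_zero_eq_one hF)
    (fun m => by simpa [smul_smul, ← mul_pow] using S.opCoeff_symm_succ hF m) m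

variable [Algebra ℚ K]

theorem opCoeff_eq_sum (hF : S.IsDeformation α F) (hh : S.IsVelocity F h) (m : ℕ) :
    S.opCoeff m F.toLinearMap = ∑ I : Composition m,
      algebraMap ℚ K ((-1) ^ I.length / (I.reverse.piU : ℚ)) •
        I.monomial fun i => S.opCoeff (i - 1) h :=
  Composition.eq_sum_of_derivative_eq_neg_mul _ (fun m => S.opCoeff m F.toLinearMap)
    (S.opCoeff_zero_eq_one hF) (hh.smul_opCoeff S) m

theorem opCoeff_symm_eq_sum (hF : S.IsDeformation α F) (hh : S.IsVelocity F h) (m : ℕ) :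
    S.opCoeff m F.symm.toLinearMap = ∑ I : Composition m,
      algebraMap ℚ K (1 / (I.piU : ℚ)) • I.monomial fun i => S.opCoeff (i - 1) h :=
  Composition.eq_sum_of_derivative_eq_mul _ (fun m => S.opCoeff m F.symm.toLinearMap)
    (S.opCoeff_symm_zero_eq_one hF) (hh.smul_opCoeff_symm S) m

/-- The coefficients of `F` are not derivations; membership comes from their expansion as
polynomials in the coefficients of `h`. -/
theorem lam_mem (hF : S.IsDeformation α F) (hh : S.IsVelocity F h)
    (B : Subalgebra K (Module.End K A₀)) (hB : ∀ m, S.opCoeff m h ∈ B) (m : ℕ) :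
    (-1 : K) ^ m • S.opCoeff m F.toLinearMap ∈ B := by
  rw [S.opCoeff_eq_sum hF hh]
  refine B.smul_mem (sum_mem fun I _ => B.smul_mem (B.list_prod_mem fun x hx => ?_) _) _
  obtain ⟨i, -, rfl⟩ := List.mem_map.1 hx
  exact hB _

end DeformationSystem

/-! ### Noncommuting variables. -/

namespace NCSeries

variable {n : ℕ} {R : Type*}

theorem tail_apply (i : Fin n) (f : NCSeries n R) (w : List (Fin n)) : tail i f w = f (i :: w) :=
  rfl

section

variable [CommRing R]

theorem X_mul_nil (i : Fin n) (f : NCSeries n R) : (X i * f : NCSeries n R) [] = 0 := by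
  simp [mul_nil, X]

theorem X_mul_cons (i j : Fin n) (f : NCSeries n R) (w : List (Fin n)) :
    (X i * f : NCSeries n R) (j :: w) = if j = i then f w else 0 := by
  have : tail j (X i : NCSeries n R) = if j = i then 1 else 0 := by
    ext v
    split_ifs with h <;> simp [tail, X, one_apply, h]
  rw [mul_cons, this]
  split_ifs <;> simp [X]

theorem algebraMap_apply (r : R) (w : List (Fin n)) :
    algebraMap R (NCSeries n R) r w = if w = [] then r else 0 := by
  rw [Algebra.algebraMap_eq_smul_one]
  simp [one_apply]

theorem sum_apply {ι : Type*} (s : Finset ι) (f : ι → NCSeries n R) (w : List (Fin n)) :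
    (∑ i ∈ s, f i) w = ∑ i ∈ s, f i w :=
  Finset.sum_apply _ _ _

theorem orderGE_mul {p q : ℕ} {f g : NCSeries n R} (hf : OrderGE p f) (hg : OrderGE q g) :
    OrderGE (p + q) (f * g) := by
  intro w hw
  rw [mul_apply]
  refine Finset.sum_eq_zero fun k _ => ?_
  by_cases h : (w.take k).length < p
  · rw [hf _ h, zero_mul]
  · rw [hg _ (by simp only [List.length_take, List.length_drop] at *; omega), mul_zero]

variable (n R) in
/-- The variables and the order of `R⟨⟨z⟩⟩`. -/
def variableSystem : VariableSystem R (NCSeries n R) (Fin n) where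
  X := X
  ε u := u []
  tail := tail
  fil d :=
    { carrier := {u | OrderGE d u}
      add_mem' := fun hf hg w hw => by simp [hf w hw, hg w hw]
      zero_mem' := fun w _ => rfl
      smul_mem' := fun r f hf w hw => by simp [hf w hw] }
  decomp u := by
    ext w
    cases w with
    | nil => simp [sum_apply, X_mul_nil, algebraMap_apply]
    | cons j w => simp [sum_apply, X_mul_cons, algebraMap_apply, tail_apply]
  mem_fil_zero u w hw := absurd hw (by simp)
  fil_anti _ _ h _ hu w hw := hu w (hw.trans_le h)
  mul_mem := orderGE_mul
  X_mem i w hw := by simp_all [X]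
  tail_mem {d u} i hu w hw := hu (i :: w) (by simp; omega)
  ε_eq_zero hu := hu [] (by simp)
  ε_algebraMap r := by simp [algebraMap_apply]
  eq_zero {u} hu := by
    ext w
    exact hu (w.length + 1) w (by simp)

theorem prod_map_apply_eq_zero {a : Fin n → NCSeries n R} (ha : ∀ i, OrderGE 1 (a i))
    (v w : List (Fin n)) (h : w.length < v.length) : (v.map a).prod w = 0 := by
  have : ∀ v : List (Fin n), OrderGE v.length (v.map a).prod := by
    intro v
    induction v with
    | nil => exact (variableSystem n R).mem_fil_zero _
    | cons i v ih =>
      rw [List.map_cons, List.prod_cons, List.length_cons, add_comm]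
      exact orderGE_mul (ha i) ih
  exact this v w h

/-- The additional summands vanish by order. A common bound `N` is what allows coefficients at
different words to be combined in a Cauchy product. -/
theorem subst_apply_of_le {a : Fin n → NCSeries n R} (ha : ∀ i, OrderGE 1 (a i))
    (u : NCSeries n R) (w : List (Fin n)) {N : ℕ} (hN : w.length + 1 ≤ N) :
    subst a u w = ∑ l ∈ Finset.range N, ∑ v : Fin l → Fin n,
      u (List.ofFn v) * ((List.ofFn v).map a).prod w := by
  refine Finset.sum_subset (Finset.range_subset_range.2 hN) fun l _ hl => ?_
  refine Finset.sum_eq_zero fun v _ => ?_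
  rw [prod_map_apply_eq_zero ha, mul_zero]
  have := List.length_ofFn (f := v)
  rw [Finset.mem_range] at hl
  omega

theorem subst_eq {a : Fin n → NCSeries n R} (ha : ∀ i, OrderGE 1 (a i)) (u : NCSeries n R) :
    subst a u = algebraMap R _ (u []) + ∑ i, a i * subst a (tail i u) := by
  ext w
  -- One extra length is admitted, so that after the empty word is split off the rest of the sum
  -- still runs over `w.length + 1` lengths.
  rw [subst_apply_of_le ha u w (Nat.le_succ (w.length + 1)), Finset.sum_range_succ', add_comm]
  simp only [add_apply, sum_apply, algebraMap_apply]
  congr 1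
  · simp [one_apply]
  · have : ∀ i, (a i * subst a (tail i u)) w =
        ∑ l ∈ Finset.range (w.length + 1), ∑ v : Fin l → Fin n,
          u (i :: List.ofFn v) * (a i * ((List.ofFn v).map a).prod) w := by
      intro i
      simp only [mul_apply, Finset.mul_sum]
      conv_rhs => enter [2, l]; rw [Finset.sum_comm]
      rw [Finset.sum_comm]
      refine Finset.sum_congr rfl fun p _ => ?_
      rw [subst_apply_of_le ha _ _ (N := w.length + 1) (by simp), Finset.mul_sum]
      refine Finset.sum_congr rfl fun l _ => ?_
      rw [Finset.mul_sum]
      refine Finset.sum_congr rfl fun v _ => ?_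
      rw [tail_apply]
      ring
    simp only [this]
    rw [Finset.sum_comm]
    refine Finset.sum_congr rfl fun l _ => ?_
    rw [← (Fin.consEquiv fun _ : Fin (l + 1) => Fin n).sum_comp, Fintype.sum_prod_type]
    refine Finset.sum_congr rfl fun i _ => Finset.sum_congr rfl fun v _ => ?_
    simp [Fin.consEquiv]

/-- An algebra homomorphism which maps the variables to series without constant term is a
substitution. -/
theorem subst_eq_map {F : Type*} [FunLike F (NCSeries n R) (NCSeries n R)]
    [AlgHomClass F R (NCSeries n R) (NCSeries n R)] (f : F)
    (hf : ∀ i, OrderGE 1 (f (X i))) (u : NCSeries n R) : subst (fun i => f (X i)) u = f u :=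
  ((variableSystem n R).map_eq_of_recursion f (s := subst fun i => f (X i)) hf
    (fun u => subst_eq hf u) u).symm

/-- The terms are split according to whether the replaced letter is the first one (`p = 0`) or a
later one, in which case the first letter is kept. -/
theorem bracket_eq (c : Fin n → NCSeries n R) (u : NCSeries n R) :
    bracket c u = ∑ i, (c i * tail i u + X i * bracket c (tail i u)) := by
  ext w
  rw [Finset.sum_add_distrib, add_apply, sum_apply, sum_apply]
  change bracketFun c u w = _
  rw [bracketFun, Finset.sum_range_succ', add_comm]
  congr 1
  · simp only [mul_apply]
    rw [Finset.sum_comm]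
    simp [tail, mul_comm]
  · cases w with
    | nil => simp [X_mul_nil]
    | cons j w =>
      have : ∑ i, (X i * bracket c (tail i u) : NCSeries n R) (j :: w) =
          bracketFun c (tail j u) w := by
        simp only [X_mul_cons, Finset.sum_ite_eq, Finset.mem_univ, if_true]
        rfl
      simp [this, bracketFun, tail]

end

section parameter

variable {K : Type*} [CommRing K]

theorem coeff_const (m : ℕ) (u : NCSeries n K) :
    tCoeff m (const u) = if m = 0 then u else 0 := by
  ext w
  simp only [tCoeff, const, PowerSeries.coeff_C]
  split_ifs <;> rfl

/-- The quotient of `f - f_{t = 0}` by `t`. -/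
noncomputable def tShift (f : NCSeries n (PowerSeries K)) : NCSeries n (PowerSeries K) :=
  fun w => PowerSeries.mk fun m => PowerSeries.coeff (m + 1) (f w)

theorem eq_const_add_X_smul_tShift (f : NCSeries n (PowerSeries K)) :
    f = const (tCoeff 0 f) + (PowerSeries.X : PowerSeries K) • tShift f := by
  ext w m
  rw [add_apply, smul_apply]
  cases m <;> simp [const, tCoeff, tShift, PowerSeries.coeff_succ_X_mul]

variable (n K) in
/-- The algebra `K[[t]]⟨⟨z⟩⟩`. -/
noncomputable def deformationSystem :
    DeformationSystem K (NCSeries n K) (NCSeries n (PowerSeries K)) (Fin n) where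
  const := const
  coeff m :=
    { toFun := tCoeff m
      map_zero' := by ext w; simp [tCoeff]
      map_add' := fun f g => by ext w; simp [tCoeff] }
  shift := tShift
  deriv :=
    { toFun := tDeriv
      map_zero' := by ext w; simp [tDeriv]
      map_add' := fun f g => by ext w : 1; simp [tDeriv] }
  ext h := by
    ext w m
    exact congrFun (h m) w
  coeff_const := coeff_const
  coeff_smul m r f := by
    ext w
    simp [tCoeff, sum_apply, PowerSeries.coeff_mul]
  coeff_mul_const m f u := by
    ext w
    simp [tCoeff, mul_apply, const]
  coeff_const_mul m f u := by
    ext w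
    simp [tCoeff, mul_apply, const]
  shift_spec := eq_const_add_X_smul_tShift
  coeff_deriv m f := by
    ext w
    have : ∀ (k : ℕ) (g : NCSeries n K), (k • g) w = k • g w := fun _ _ => rfl
    simp [tCoeff, tDeriv, this, PowerSeries.coeff_derivative, mul_comm]
  deriv_mul f g := by
    ext w : 1
    simp only [AddMonoidHom.coe_mk, ZeroHom.coe_mk, tDeriv, mul_apply, add_apply, map_sum,
      Derivation.leibniz, smul_eq_mul, ← Finset.sum_add_distrib]
    exact Finset.sum_congr rfl fun _ _ => by ring
  deriv_smul r f := by
    ext w : 1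
    simp only [AddMonoidHom.coe_mk, ZeroHom.coe_mk, tDeriv, add_apply, smul_apply,
      Derivation.leibniz, smul_eq_mul]
    ring
  V₀ := variableSystem n K
  V := variableSystem n (PowerSeries K)
  const_X i := by
    ext w : 1
    simp only [variableSystem, const, X]
    split_ifs <;> simp
  const_mem hu w hw := by simp [const, hu w hw]
  coeff_mem m hf w hw := by simp [tCoeff, hf w hw]
  deriv_mem hf w hw := by simp [tDeriv, hf w hw]

variable {α : ℕ} {F : NCSeries n (PowerSeries K) ≃ₐ[PowerSeries K] NCSeries n (PowerSeries K)}

theorem lam_eq (m : ℕ) :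
    lam F m = (-1 : K) ^ m • (deformationSystem n K).opCoeff m F.toLinearMap := rfl

theorem orderGE_apply_X (hα : 1 ≤ α) (hF : IsDeformation α F) (i : Fin n) :
    OrderGE 1 (F (X i)) :=
  (variableSystem n (PowerSeries K)).map_X_mem F hα (fun i => (hF i).1) i

theorem orderGE_symm_apply_X (hα : 1 ≤ α) (hF : IsDeformation α F) (i : Fin n) :
    OrderGE 1 (F.symm (X i)) :=
  (variableSystem n (PowerSeries K)).symm_X_mem F (orderGE_apply_X hα hF) i

/-- Substituting `F(z)` is applying `F`, so the recursion for the bracket is the defining recursion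
of a velocity. -/
theorem isVelocity_hOp (hα : 1 ≤ α) (hF : IsDeformation α F) :
    (deformationSystem n K).IsVelocity F (hOp F) := by
  intro u
  have hs : ∀ u, subst (tuple F) u = F u := subst_eq_map F (orderGE_apply_X hα hF)
  rw [hOp, bracket_eq]
  simp only [hs]
  rfl

theorem eq_const_add_tSum {f : NCSeries n (PowerSeries K)} {u : NCSeries n K}
    {a : ℕ → NCSeries n K} (h0 : tCoeff 0 f = u) (h : ∀ m, tCoeff m f = a m) :
    f = const u + tSum a := by
  ext w m
  have hm : PowerSeries.coeff m (f w) = a m w := congrFun (h m) w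
  have h0w : PowerSeries.coeff 0 (f w) = u w := congrFun h0 w
  rw [add_apply, map_add]
  simp only [const, tSum, PowerSeries.coeff_C, PowerSeries.coeff_mk]
  split_ifs with h1 h2 h2
  · omega
  · simp_all
  · simp_all
  · omega

theorem hOp_opCoeff_mem_diffOps (hα : 1 ≤ α) (hF : IsDeformation α F) (m : ℕ) :
    (deformationSystem n K).opCoeff m (hOp F) ∈ diffOps n K α :=
  Algebra.subset_adjoin ⟨(isVelocity_hOp hα hF).opCoeff_mul _ m,
    fun _ _ _ hu he =>
      (isVelocity_hOp hα hF).opCoeff_mem (deformationSystem n K) hα hF m hu he⟩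

theorem expansions [Algebra ℚ K] (hα : 1 ≤ α) (hF : IsDeformation α F) :
    (∀ m, 1 ≤ m → lam F m ∈ diffOps n K α) ∧ (∀ m, 1 ≤ m → psi F m ∈ diffOps n K α) ∧
    ∀ u : NCSeries n K,
      subst (tuple F) (const u) =
        const u + tSum (fun m => (-1 : K) ^ m • lam F m u) ∧
      subst (tuple F) (const u) =
        const u + tSum (fun m => ∑ I : Composition m,
          algebraMap ℚ K ((-1) ^ I.length / (I.reverse.piU : ℚ)) • I.monomial (psi F) u) ∧
      subst (tuple F.symm) (const u) =
        const u + tSum (fun m => ∑ I : Composition m,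
          (-1 : K) ^ (m - I.length) • I.monomial (lam F) u) ∧
      subst (tuple F.symm) (const u) =
        const u + tSum (fun m => ∑ I : Composition m,
          algebraMap ℚ K (1 / (I.piU : ℚ)) • I.monomial (psi F) u) := by
  have hV := isVelocity_hOp hα hF
  refine ⟨fun m _ => (deformationSystem n K).lam_mem hF hV _ (hOp_opCoeff_mem_diffOps hα hF) m,
    fun m _ => hOp_opCoeff_mem_diffOps hα hF _, fun u => ?_⟩
  have hs : subst (tuple F) (const u) = F (const u) :=
    subst_eq_map F (orderGE_apply_X hα hF) _
  have hs' : subst (tuple F.symm) (const u) = F.symm (const u) :=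
    subst_eq_map F.symm (orderGE_symm_apply_X hα hF) _
  have h0 : tCoeff 0 (F (const u)) = u :=
    LinearMap.congr_fun ((deformationSystem n K).opCoeff_zero_eq_one hF) u
  have h0' : tCoeff 0 (F.symm (const u)) = u :=
    LinearMap.congr_fun ((deformationSystem n K).opCoeff_symm_zero_eq_one hF) u
  rw [hs, hs']
  refine ⟨eq_const_add_tSum h0 fun m => ?_, eq_const_add_tSum h0 fun m => ?_,
    eq_const_add_tSum h0' fun m => ?_, eq_const_add_tSum h0' fun m => ?_⟩
  · rw [lam_eq, LinearMap.smul_apply, smul_smul, ← mul_pow, neg_one_mul, neg_neg, one_pow,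
      one_smul]
    rfl
  · have := LinearMap.congr_fun ((deformationSystem n K).opCoeff_eq_sum hF hV m) u
    rw [LinearMap.sum_apply] at this
    exact this
  · have := LinearMap.congr_fun ((deformationSystem n K).opCoeff_symm_eq_sum_lam hF m) u
    rw [LinearMap.sum_apply] at this
    exact this
  · have := LinearMap.congr_fun ((deformationSystem n K).opCoeff_symm_eq_sum hF hV m) u
    rw [LinearMap.sum_apply] at this
    exact this

end parameter

end NCSeries

/-! ### Commuting variables. -/

namespace CommSeries

open MvPowerSeries

variable {n : ℕ} {R : Type*} [CommRing R]

/-- The sum of the terms of `u` whose first variable is `zᵢ`, divided by `zᵢ`. -/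
noncomputable def tail (i : Fin n) (u : MvPowerSeries (Fin n) R) : MvPowerSeries (Fin n) R := fun m =>
  if ∀ j < i, m j = 0 then coeff (m + Finsupp.single i 1) u else 0

theorem coeff_tail (i : Fin n) (u : MvPowerSeries (Fin n) R) (m : Fin n →₀ ℕ) :
    coeff m (tail i u) = if ∀ j < i, m j = 0 then coeff (m + Finsupp.single i 1) u else 0 := rfl

theorem coeff_X_mul_tail (i : Fin n) (u : MvPowerSeries (Fin n) R) (m : Fin n →₀ ℕ) :
    coeff m (X i * tail i u) = if m i ≠ 0 ∧ ∀ j < i, m j = 0 then coeff m u else 0 := by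
  classical
  by_cases h : m i = 0
  · rw [if_neg (by simp [h])]
    exact (X_dvd_iff.1 (dvd_mul_right _ _)) m h
  · obtain ⟨m', rfl⟩ : ∃ m', m = m' + Finsupp.single i 1 := by
      refine ⟨m - Finsupp.single i 1, (tsub_add_cancel_of_le ?_).symm⟩
      rw [Finsupp.single_le_iff]
      omega
    rw [add_comm, X, coeff_add_monomial_mul, one_mul, coeff_tail, add_comm]
    refine if_congr ?_ rfl rfl
    refine ⟨fun h' => ⟨by simp, fun j hj => ?_⟩, fun h' j hj => ?_⟩
    · simp [h' j hj, hj.ne']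
    · have := h'.2 j hj
      simp_all

/-- A monomial may be divisible by several variables; assigning it to the least of them makes each
nonconstant monomial occur in exactly one summand. -/
theorem eq_C_add_sum (u : MvPowerSeries (Fin n) R) :
    u = C (constantCoeff u) + ∑ i, X i * tail i u := by
  classical
  ext m
  simp only [map_add, map_sum, coeff_X_mul_tail, coeff_C]
  by_cases hm : m = 0
  · simp [hm]
  · obtain ⟨i, hi, hmin⟩ : ∃ i, m i ≠ 0 ∧ ∀ j < i, m j = 0 := by
      have hne : m.support.Nonempty := Finsupp.support_nonempty_iff.2 hm
      refine ⟨m.support.min' hne, by simpa using m.support.min'_mem hne, fun j hj => ?_⟩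
      by_contra h
      exact absurd (m.support.min'_le j (by simpa using h)) (not_le.2 hj)
    rw [if_neg hm, zero_add, Finset.sum_eq_single i, if_pos ⟨hi, hmin⟩]
    · intro j _ hj
      refine if_neg fun h => ?_
      rcases lt_or_gt_of_ne hj with h' | h'
      · exact h.1 (hmin j h')
      · exact hi (h.2 i h')
    · simp

theorem natCast_le_order_iff {d : ℕ} {u : MvPowerSeries (Fin n) R} :
    (d : ℕ∞) ≤ u.order ↔ ∀ m : Fin n →₀ ℕ, m.degree < d → coeff m u = 0 :=
  ⟨fun h m hm => coeff_of_lt_order (lt_of_lt_of_le (by exact_mod_cast hm) h), nat_le_order⟩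

variable (n R) in
/-- The series of order at least `d`. -/
noncomputable def orderFiltration (d : ℕ) : Submodule R (MvPowerSeries (Fin n) R) where
  carrier := {u | (d : ℕ∞) ≤ u.order}
  add_mem' := fun hf hg => (le_min hf hg).trans min_order_le_add
  zero_mem' := by simp
  smul_mem' := fun r f hf => le_trans hf le_order_smul

theorem mem_orderFiltration {d : ℕ} {u : MvPowerSeries (Fin n) R} :
    u ∈ orderFiltration n R d ↔ (d : ℕ∞) ≤ u.order := Iff.rfl

variable (n R) in
/-- The variables and the order of `R[[z]]`. -/
noncomputable def variableSystem : VariableSystem R (MvPowerSeries (Fin n) R) (Fin n) where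
  X := X
  ε u := constantCoeff u
  tail := tail
  fil := orderFiltration n R
  decomp := eq_C_add_sum
  mem_fil_zero u := by simp [mem_orderFiltration]
  fil_anti _ _ h _ hu := (Nat.cast_le.2 h).trans (mem_orderFiltration.1 hu)
  mul_mem hf hg := by
    refine mem_orderFiltration.2 (le_trans ?_ le_order_mul)
    push_cast
    exact add_le_add hf hg
  X_mem i := by simp [mem_orderFiltration, one_le_order_iff_constCoeff_eq_zero]
  tail_mem {d u} i hu := by
    refine natCast_le_order_iff.2 fun m hm => ?_
    rw [coeff_tail]
    split_ifs
    · exact natCast_le_order_iff.1 hu _ (by simp; omega)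
    · rfl
  ε_eq_zero {u} hu := one_le_order_iff_constCoeff_eq_zero.1 (by simpa [mem_orderFiltration] using hu)
  ε_algebraMap r := by simp [MvPowerSeries.algebraMap_apply]
  eq_zero {u} hu := by
    ext m
    exact natCast_le_order_iff.1 (hu (m.degree + 1)) m (by simp)

/-- An algebra homomorphism which maps the variables to series without constant term is a
substitution. -/
theorem subst_eq_map {F : Type*}
    [FunLike F (MvPowerSeries (Fin n) R) (MvPowerSeries (Fin n) R)]
    [AlgHomClass F R (MvPowerSeries (Fin n) R) (MvPowerSeries (Fin n) R)] (f : F)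
    (hf : ∀ i, f (X i) ∈ (variableSystem n R).fil 1) (u : MvPowerSeries (Fin n) R) :
    subst (fun i => f (X i)) u = f u := by
  have hs : HasSubst fun i => f (X i) := hasSubst_of_constantCoeff_zero fun i =>
    (variableSystem n R).ε_eq_zero (hf i)
  refine ((variableSystem n R).map_eq_of_recursion f (s := subst fun i => f (X i)) hf
    (fun u => ?_) u).symm
  -- Substitution is itself an algebra homomorphism with the same values on the variables, which
  -- gives the required recursion.
  have := (variableSystem n R).map_decomp (substAlgHom hs : _ →ₐ[R] _) u
  simpa [variableSystem, subst_X hs, coe_substAlgHom] using this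

theorem bracket_mul (c : Fin n → MvPowerSeries (Fin n) R) (u v : MvPowerSeries (Fin n) R) :
    bracket c (u * v) = bracket c u * v + u * bracket c v := by
  simp only [bracket, LinearMap.sum_apply, LinearMap.comp_apply, LinearMap.mulLeft_apply,
    Derivation.coeFn_coe, Derivation.leibniz, smul_eq_mul, Finset.sum_mul, Finset.mul_sum,
    ← Finset.sum_add_distrib]
  exact Finset.sum_congr rfl fun _ _ => by ring

theorem bracket_X (c : Fin n → MvPowerSeries (Fin n) R) (i : Fin n) : bracket c (X i) = c i := by
  classical
  simp [bracket, LinearMap.sum_apply, pderiv_X, Pi.single_apply]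

theorem bracket_C (c : Fin n → MvPowerSeries (Fin n) R) (r : R) : bracket c (C r) = 0 := by
  simp [bracket, LinearMap.sum_apply]

theorem bracket_eq (c : Fin n → MvPowerSeries (Fin n) R) (u : MvPowerSeries (Fin n) R) :
    bracket c u = ∑ i, (c i * tail i u + X i * bracket c (tail i u)) := by
  conv_lhs => rw [eq_C_add_sum u]
  simp only [map_add, map_sum, bracket_C, bracket_mul, bracket_X, zero_add]

section parameter

variable {K : Type*} [CommRing K]

theorem coeff_const (w : Fin n →₀ ℕ) (u : MvPowerSeries (Fin n) K) :
    coeff w (const u) = PowerSeries.C (coeff w u) := by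
  simp [const]

theorem coeff_tDeriv (w : Fin n →₀ ℕ) (f : MvPowerSeries (Fin n) (PowerSeries K)) :
    coeff w (tDeriv f) = PowerSeries.derivative K (coeff w f) := rfl

theorem coeff_tSum (w : Fin n →₀ ℕ) (a : ℕ → MvPowerSeries (Fin n) K) :
    coeff w (tSum a) = PowerSeries.mk fun m => if 1 ≤ m then coeff w (a m) else 0 := rfl

/-- The quotient of `f - f_{t = 0}` by `t`. -/
noncomputable def tShift (f : MvPowerSeries (Fin n) (PowerSeries K)) :
    MvPowerSeries (Fin n) (PowerSeries K) :=
  fun w => PowerSeries.mk fun m => PowerSeries.coeff (m + 1) (coeff w f)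

theorem coeff_tShift (w : Fin n →₀ ℕ) (f : MvPowerSeries (Fin n) (PowerSeries K)) :
    coeff w (tShift f) = PowerSeries.mk fun m => PowerSeries.coeff (m + 1) (coeff w f) := rfl

theorem eq_const_add_X_smul_tShift (f : MvPowerSeries (Fin n) (PowerSeries K)) :
    f = const (tCoeff 0 f) + (PowerSeries.X : PowerSeries K) • tShift f := by
  ext w m
  rw [map_add, coeff_const, coeff_tCoeff, coeff_smul, coeff_tShift]
  cases m <;> simp [PowerSeries.coeff_succ_X_mul]

variable (n K) in
/-- The algebra `K[[t]][[z]]`. -/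
noncomputable def deformationSystem :
    DeformationSystem K (MvPowerSeries (Fin n) K) (MvPowerSeries (Fin n) (PowerSeries K))
      (Fin n) where
  const := const
  coeff m :=
    { toFun := tCoeff m
      map_zero' := by ext w; simp [coeff_tCoeff]
      map_add' := fun f g => by ext w; simp [coeff_tCoeff] }
  shift := tShift
  deriv :=
    { toFun := tDeriv
      map_zero' := by ext w : 1; simp [coeff_tDeriv]
      map_add' := fun f g => by ext w : 1; simp [coeff_tDeriv] }
  ext h := by
    ext w m
    exact congrArg (coeff w) (h m)
  coeff_const m u := by
    ext w
    simp only [AddMonoidHom.coe_mk, ZeroHom.coe_mk, coeff_tCoeff, coeff_const,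
      PowerSeries.coeff_C]
    split_ifs <;> simp
  coeff_smul m r f := by
    ext w
    simp [coeff_tCoeff, PowerSeries.coeff_mul]
  coeff_mul_const m f u := by
    classical
    ext w
    simp [coeff_tCoeff, coeff_mul, coeff_const]
  coeff_const_mul m f u := by
    classical
    ext w
    simp [coeff_tCoeff, coeff_mul, coeff_const]
  shift_spec := eq_const_add_X_smul_tShift
  coeff_deriv m f := by
    ext w
    rw [map_nsmul]
    simp only [AddMonoidHom.coe_mk, ZeroHom.coe_mk, coeff_tCoeff, coeff_tDeriv,
      PowerSeries.coeff_derivative, nsmul_eq_mul]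
    push_cast
    ring
  deriv_mul f g := by
    classical
    ext w : 1
    simp only [AddMonoidHom.coe_mk, ZeroHom.coe_mk, coeff_tDeriv, coeff_mul, map_add, map_sum,
      Derivation.leibniz, smul_eq_mul, ← Finset.sum_add_distrib]
    exact Finset.sum_congr rfl fun _ _ => by ring
  deriv_smul r f := by
    ext w : 1
    simp only [AddMonoidHom.coe_mk, ZeroHom.coe_mk, coeff_tDeriv, map_add, coeff_smul,
      Derivation.leibniz, smul_eq_mul]
    ring
  V₀ := variableSystem n K
  V := variableSystem n (PowerSeries K)
  const_X i := by simp [variableSystem, const]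
  const_mem hu := natCast_le_order_iff.2 fun w hw => by
    rw [coeff_const, natCast_le_order_iff.1 hu w hw, map_zero]
  coeff_mem m hf := natCast_le_order_iff.2 fun w hw => by
    simp [coeff_tCoeff, natCast_le_order_iff.1 hf w hw]
  deriv_mem hf := natCast_le_order_iff.2 fun w hw => by
    simp [coeff_tDeriv, natCast_le_order_iff.1 hf w hw]

variable {α : ℕ} {F : MvPowerSeries (Fin n) (PowerSeries K) ≃ₐ[PowerSeries K]
  MvPowerSeries (Fin n) (PowerSeries K)}

theorem lam_eq (m : ℕ) :
    lam F m = (-1 : K) ^ m • (deformationSystem n K).opCoeff m F.toLinearMap := rfl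

theorem apply_X_mem (hα : 1 ≤ α) (hF : IsDeformation α F) (i : Fin n) :
    F (X i) ∈ (variableSystem n (PowerSeries K)).fil 1 :=
  (variableSystem n (PowerSeries K)).map_X_mem F hα (fun i => (hF i).1) i

theorem symm_apply_X_mem (hα : 1 ≤ α) (hF : IsDeformation α F) (i : Fin n) :
    F.symm (X i) ∈ (variableSystem n (PowerSeries K)).fil 1 :=
  (variableSystem n (PowerSeries K)).symm_X_mem F (apply_X_mem hα hF) i

theorem isVelocity_hOp (hα : 1 ≤ α) (hF : IsDeformation α F) :
    (deformationSystem n K).IsVelocity F (hOp F) := by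
  intro u
  have hs : ∀ u, subst (tuple F) u = F u := subst_eq_map F (apply_X_mem hα hF)
  rw [hOp, bracket_eq]
  simp only [hs]
  rfl

theorem eq_const_add_tSum {f : MvPowerSeries (Fin n) (PowerSeries K)}
    {u : MvPowerSeries (Fin n) K} {a : ℕ → MvPowerSeries (Fin n) K} (h0 : tCoeff 0 f = u)
    (h : ∀ m, tCoeff m f = a m) : f = const u + tSum a := by
  ext w m
  have hm : PowerSeries.coeff m (coeff w f) = coeff w (a m) := congrArg (coeff w) (h m)
  have h0w : PowerSeries.coeff 0 (coeff w f) = coeff w u := congrArg (coeff w) h0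
  rw [map_add, map_add]
  simp only [coeff_const, coeff_tSum, PowerSeries.coeff_C, PowerSeries.coeff_mk]
  split_ifs with h1 h2 h2
  · omega
  · simp_all
  · simp_all
  · omega

theorem hOp_opCoeff_mem_diffOps (hα : 1 ≤ α) (hF : IsDeformation α F) (m : ℕ) :
    (deformationSystem n K).opCoeff m (hOp F) ∈ diffOps n K α := by
  refine Algebra.subset_adjoin ⟨(isVelocity_hOp hα hF).opCoeff_mul _ m, fun u => ?_⟩
  -- The order of `0` is `⊤`, so the filtration by natural numbers is applied only to nonzero `u`.
  by_cases hu : u = 0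
  · simp [hu]
  · have hd : (u.order.toNat : ℕ∞) = u.order := ne_zero_iff_order_finite.1 hu
    -- The truncated subtraction in `e` is exact because `1 ≤ α`.
    have := (isVelocity_hOp hα hF).opCoeff_mem (deformationSystem n K) hα hF m
      (d := u.order.toNat) (e := u.order.toNat + α - 1) (u := u) hd.le (by omega)
    have h' : ((u.order.toNat + α - 1 : ℕ) : ℕ∞) + 1 ≤
        ((deformationSystem n K).opCoeff m (hOp F) u).order + 1 := by
      gcongr
      exact this
    refine le_trans ?_ h'
    rw [← hd]
    exact_mod_cast (by simp; omega)

theorem expansions [Algebra ℚ K] (hα : 1 ≤ α) (hF : IsDeformation α F) :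
    (∀ m, 1 ≤ m → lam F m ∈ diffOps n K α) ∧ (∀ m, 1 ≤ m → psi F m ∈ diffOps n K α) ∧
    ∀ u : MvPowerSeries (Fin n) K,
      subst (tuple F) (const u) =
        const u + tSum (fun m => (-1 : K) ^ m • lam F m u) ∧
      subst (tuple F) (const u) =
        const u + tSum (fun m => ∑ I : Composition m,
          algebraMap ℚ K ((-1) ^ I.length / (I.reverse.piU : ℚ)) • I.monomial (psi F) u) ∧
      subst (tuple F.symm) (const u) =
        const u + tSum (fun m => ∑ I : Composition m,
          (-1 : K) ^ (m - I.length) • I.monomial (lam F) u) ∧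
      subst (tuple F.symm) (const u) =
        const u + tSum (fun m => ∑ I : Composition m,
          algebraMap ℚ K (1 / (I.piU : ℚ)) • I.monomial (psi F) u) := by
  have hV := isVelocity_hOp hα hF
  refine ⟨fun m _ => (deformationSystem n K).lam_mem hF hV _ (hOp_opCoeff_mem_diffOps hα hF) m,
    fun m _ => hOp_opCoeff_mem_diffOps hα hF _, fun u => ?_⟩
  have hs : subst (tuple F) (const u) = F (const u) :=
    subst_eq_map F (apply_X_mem hα hF) _
  have hs' : subst (tuple F.symm) (const u) = F.symm (const u) :=
    subst_eq_map F.symm (symm_apply_X_mem hα hF) _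
  have h0 : tCoeff 0 (F (const u)) = u :=
    LinearMap.congr_fun ((deformationSystem n K).opCoeff_zero_eq_one hF) u
  have h0' : tCoeff 0 (F.symm (const u)) = u :=
    LinearMap.congr_fun ((deformationSystem n K).opCoeff_symm_zero_eq_one hF) u
  rw [hs, hs']
  refine ⟨eq_const_add_tSum h0 fun m => ?_, eq_const_add_tSum h0 fun m => ?_,
    eq_const_add_tSum h0' fun m => ?_, eq_const_add_tSum h0' fun m => ?_⟩
  · rw [lam_eq, LinearMap.smul_apply, smul_smul, ← mul_pow, neg_one_mul, neg_neg, one_pow,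
      one_smul]
    rfl
  · have := LinearMap.congr_fun ((deformationSystem n K).opCoeff_eq_sum hF hV m) u
    rw [LinearMap.sum_apply] at this
    exact this
  · have := LinearMap.congr_fun ((deformationSystem n K).opCoeff_symm_eq_sum_lam hF m) u
    rw [LinearMap.sum_apply] at this
    exact this
  · have := LinearMap.congr_fun ((deformationSystem n K).opCoeff_symm_eq_sum hF hV m) u
    rw [LinearMap.sum_apply] at this
    exact this

end parameter

end CommSeries

theorem mainTheorem5 (K : Type*) [CommRing K] [Algebra ℚ K] (n α : ℕ) (hα : 1 ≤ α) :
    -- noncommuting variables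
    (∀ F : NCSeries n (PowerSeries K) ≃ₐ[PowerSeries K] NCSeries n (PowerSeries K),
      NCSeries.IsDeformation α F →
        (∀ m, 1 ≤ m → NCSeries.lam F m ∈ NCSeries.diffOps n K α) ∧
        (∀ m, 1 ≤ m → NCSeries.psi F m ∈ NCSeries.diffOps n K α) ∧
        ∀ u : NCSeries n K,
          NCSeries.subst (NCSeries.tuple F) (NCSeries.const u) =
              NCSeries.const u +
                NCSeries.tSum (fun m => (-1 : K) ^ m • NCSeries.lam F m u) ∧
          NCSeries.subst (NCSeries.tuple F) (NCSeries.const u) =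
              NCSeries.const u +
                NCSeries.tSum (fun m => ∑ I : Composition m,
                  algebraMap ℚ K ((-1) ^ I.length / (I.reverse.piU : ℚ)) •
                    I.monomial (NCSeries.psi F) u) ∧
          NCSeries.subst (NCSeries.tuple F.symm) (NCSeries.const u) =
              NCSeries.const u +
                NCSeries.tSum (fun m => ∑ I : Composition m,
                  (-1 : K) ^ (m - I.length) • I.monomial (NCSeries.lam F) u) ∧
          NCSeries.subst (NCSeries.tuple F.symm) (NCSeries.const u) =
              NCSeries.const u +
                NCSeries.tSum (fun m => ∑ I : Composition m,
                  algebraMap ℚ K (1 / (I.piU : ℚ)) •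
                    I.monomial (NCSeries.psi F) u)) ∧
    -- commuting variables
    (∀ F : MvPowerSeries (Fin n) (PowerSeries K) ≃ₐ[PowerSeries K]
        MvPowerSeries (Fin n) (PowerSeries K),
      CommSeries.IsDeformation α F →
        (∀ m, 1 ≤ m → CommSeries.lam F m ∈ CommSeries.diffOps n K α) ∧
        (∀ m, 1 ≤ m → CommSeries.psi F m ∈ CommSeries.diffOps n K α) ∧
        ∀ u : MvPowerSeries (Fin n) K,
          MvPowerSeries.subst (CommSeries.tuple F) (CommSeries.const u) =
              CommSeries.const u +
                CommSeries.tSum (fun m => (-1 : K) ^ m • CommSeries.lam F m u) ∧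
          MvPowerSeries.subst (CommSeries.tuple F) (CommSeries.const u) =
              CommSeries.const u +
                CommSeries.tSum (fun m => ∑ I : Composition m,
                  algebraMap ℚ K ((-1) ^ I.length / (I.reverse.piU : ℚ)) •
                    I.monomial (CommSeries.psi F) u) ∧
          MvPowerSeries.subst (CommSeries.tuple F.symm) (CommSeries.const u) =
              CommSeries.const u +
                CommSeries.tSum (fun m => ∑ I : Composition m,
                  (-1 : K) ^ (m - I.length) • I.monomial (CommSeries.lam F) u) ∧
          MvPowerSeries.subst (CommSeries.tuple F.symm) (CommSeries.const u) =
              CommSeries.const u +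
                CommSeries.tSum (fun m => ∑ I : Composition m,
                  algebraMap ℚ K (1 / (I.piU : ℚ)) •
                    I.monomial (CommSeries.psi F) u)) :=
  ⟨fun _ hF => NCSeries.expansions hα hF, fun _ hF => CommSeries.expansions hα hF⟩
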